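/- All graphs are finite, simple and undirected. For a graph $G$ and a vertex $v\in V(G)$, let the local component number $c_L(v)$ be the number of connected components of the subgraph of $G$ induced by the neighbourhood $N(v)$. Write $H_1\prec H_2$ if $H_2$ has an induced subgraph isomorphic to $H_1$. For families $\mathcal H_1,\mathcal H_2$ of graphs, write $\mathcal H_1\le\mathcal H_2$ if for every $H_2\in\mathcal H_2$ there is an $H_1\in\mathcal H_1$ with $H_1\prec H_2$. A graph $G$ is $\mathcal H$-free if there is no $H\in\mathcal H$ with $H\prec G$. For a positive integer $n$, let $K_n$, $E_n$, $P_n$ be the complete graph, the edgeless graph and the path on $n$ vertices, $K_{s,t}$ the complete bipartite graph with parts of orders $s$ and $t$, and $nP_3$ the disjoint union of $n$ copies of $P_3$. Further, let - $K_n^*$ be the graph obtained by attaching one pendant vertex to each vertex of $K_n$; - $K_{1,n}^*$ be the graph obtained by attaching one pendant vertex to each of the $n$ leaves of the star $K_{1,n}$; - $CK_n$ be the graph obtained from two disjoint copies of $K_n$ by adding a perfect matching between them; - $T_n$ be the graph obtained from the join of $K_n$ and $E_n$ (the disjoint union of $K_n$ and $E_n$ together with all edges between them) by adding a new vertex whose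 neighbours are exactly the vertices of $E_n$. **Corollary.** Let $\mathcal H$ be a family of graphs. The following are equivalent: 1. there is a constant $c=c(\mathcal H)$ such that every $\mathcal H$-free graph $G$ has fewer than $c$ vertices $v$ with $c_L(v)\ge 2$; 2. there is a positive integer $n$ such that $\mathcal H\le\{K_n^*,\ nP_3,\ K_{1,n}^*,\ K_{2,n},\ CK_n,\ T_n\}$. -/

import Mathlib

universe u v

namespace LocalComponent

/-- A finite simple undirected graph, bundled with its vertex set. -/
structure FinGraph : Type (u + 1) where
  V : Type u
  [fin : Finite V]
  graph : SimpleGraph V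

attribute [instance] FinGraph.fin

/-- `H₁ ≺ H₂`: the graph `H₂` contains an induced subgraph isomorphic to `H₁`. -/
def InducedIn (H₁ : FinGraph.{u}) (H₂ : FinGraph.{v}) : Prop :=
  Nonempty (H₁.graph ↪g H₂.graph)

/-- `G` contains no member of the family as an induced subgraph. -/
def IsFree (𝓗 : Set FinGraph.{u}) (G : FinGraph.{v}) : Prop :=
  ¬ ∃ H ∈ 𝓗, InducedIn H G

/-- `𝓗₁ ≤ 𝓗₂` for families of graphs: every member of `𝓗₂` contains some member of `𝓗₁`
as an induced subgraph. -/
def FamilyLE (𝓗₁ : Set FinGraph.{u}) (𝓗₂ : Set FinGraph.{v}) : Prop :=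
  ∀ H₂ ∈ 𝓗₂, ∃ H₁ ∈ 𝓗₁, InducedIn H₁ H₂

/-- The number `c(S)` of connected components of the induced subgraph `G[S]`. -/
noncomputable def numComponents (G : FinGraph.{u}) (S : Set G.V) : ℕ :=
  Nat.card (G.graph.induce S).ConnectedComponent

/-- The local component number `c_L(v) = c(N(v))`. -/
noncomputable def localComponentNumber (G : FinGraph.{u}) (v : G.V) : ℕ :=
  numComponents G (G.graph.neighborSet v)

/-- `p_k(G)`: the number of vertices `v` of `G` with `p(v) ≥ k`. -/
noncomputable def countGE (p : (G : FinGraph.{u}) → G.V → ℕ) (k : ℕ) (G : FinGraph.{u}) : ℕ :=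
  {v : G.V | k ≤ p G v}.ncard

/-- `B₂(p)`: the families `𝓗` such that `p₂(G)` is bounded over all `𝓗`-free graphs `G`. -/
def B₂ (p : (G : FinGraph.{u}) → G.V → ℕ) : Set (Set FinGraph.{u}) :=
  {𝓗 | ∃ c : ℕ, ∀ G : FinGraph.{u}, IsFree 𝓗 G → countGE p 2 G < c}

/-- Adjacency of `K*_n`: the complete graph on the left vertices, and the right vertex `inr i`
is a pendant attached to `inl i`. -/
def kStarAdj (n : ℕ) : Fin n ⊕ Fin n → Fin n ⊕ Fin n → Prop
  | .inl i, .inl j => i ≠ j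
  | .inl i, .inr j => i = j
  | .inr i, .inl j => i = j
  | .inr _, .inr _ => False

/-- `K*_n`: a pendant is added to each vertex of `K_n`. -/
abbrev kStar (n : ℕ) : FinGraph.{0} where
  V := Fin n ⊕ Fin n
  graph :=
    { Adj := kStarAdj n
      symm := ⟨by rintro (i | i) (j | j) h <;> simp_all [kStarAdj, eq_comm]⟩
      loopless := ⟨by rintro (i | i) h <;> simp_all [kStarAdj]⟩ }

/-- `nG`: the disjoint union of `n` copies of `G`. -/
abbrev copies (n : ℕ) (G : FinGraph.{u}) : FinGraph.{u} where
  V := Fin n × G.V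
  graph :=
    { Adj := fun x y => x.1 = y.1 ∧ G.graph.Adj x.2 y.2
      symm := ⟨fun _ _ h => ⟨h.1.symm, h.2.symm⟩⟩
      loopless := ⟨fun _ h => G.graph.irrefl h.2⟩ }

/-- `P_n`: the path on `n` vertices. -/
abbrev path (n : ℕ) : FinGraph.{0} where
  V := Fin n
  graph := SimpleGraph.pathGraph n

/-- Adjacency of `K*_{1,n}`: `inl ()` is the centre, `inr (inl i)` are the leaves of the star, and
`inr (inr i)` is a pendant attached to the leaf `inr (inl i)`. -/
def starStarAdj (n : ℕ) : Unit ⊕ (Fin n ⊕ Fin n) → Unit ⊕ (Fin n ⊕ Fin n) → Prop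
  | .inl _, .inr (.inl _) => True
  | .inr (.inl _), .inl _ => True
  | .inr (.inl i), .inr (.inr j) => i = j
  | .inr (.inr i), .inr (.inl j) => i = j
  | _, _ => False

/-- `K*_{1,n}`: a pendant is added to each leaf of the star `K_{1,n}`. -/
abbrev starStar (n : ℕ) : FinGraph.{0} where
  V := Unit ⊕ (Fin n ⊕ Fin n)
  graph :=
    { Adj := starStarAdj n
      symm := ⟨by rintro (i | i | i) (j | j | j) h <;> simp_all [starStarAdj]⟩
      loopless := ⟨by rintro (i | i | i) h <;> simp_all [starStarAdj]⟩ }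

/-- `K_{s,t}`: the complete bipartite graph with parts of orders `s` and `t`. -/
abbrev completeBipartite (s t : ℕ) : FinGraph.{0} where
  V := Fin s ⊕ Fin t
  graph := completeBipartiteGraph (Fin s) (Fin t)

/-- Adjacency of `CK_n`: both sides are complete, and `inl i` is matched with `inr i`. -/
def cliquePairAdj (n : ℕ) : Fin n ⊕ Fin n → Fin n ⊕ Fin n → Prop
  | .inl i, .inl j => i ≠ j
  | .inl i, .inr j => i = j
  | .inr i, .inl j => i = j
  | .inr i, .inr j => i ≠ j

/-- `CK_n`: a perfect matching is added between two disjoint copies of `K_n`. -/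
abbrev cliquePair (n : ℕ) : FinGraph.{0} where
  V := Fin n ⊕ Fin n
  graph :=
    { Adj := cliquePairAdj n
      symm := ⟨by rintro (i | i) (j | j) h <;> simp_all [cliquePairAdj, eq_comm]⟩
      loopless := ⟨by rintro (i | i) h <;> simp_all [cliquePairAdj]⟩ }

/-- Adjacency of `T_n`: `inl i` are the vertices of `K_n`, `inr (inl i)` those of `E_n`, and
`inr (inr ())` is the new vertex. -/
def tAdj (n : ℕ) : Fin n ⊕ (Fin n ⊕ Unit) → Fin n ⊕ (Fin n ⊕ Unit) → Prop
  | .inl i, .inl j => i ≠ j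
  | .inl _, .inr (.inl _) => True
  | .inr (.inl _), .inl _ => True
  | .inr (.inl _), .inr (.inr _) => True
  | .inr (.inr _), .inr (.inl _) => True
  | _, _ => False

/-- `T_n`: a new vertex, adjacent exactly to the vertices of the edgeless graph `E_n`, is added to
the join `K_n + E_n`. -/
abbrev tGraph (n : ℕ) : FinGraph.{0} where
  V := Fin n ⊕ (Fin n ⊕ Unit)
  graph :=
    { Adj := tAdj n
      symm := ⟨by rintro (i | i | i) (j | j | j) h <;> simp_all [tAdj, eq_comm]⟩
      loopless := ⟨by rintro (i | i | i) h <;> simp_all [tAdj]⟩ }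

end LocalComponent

/-! Call a vertex special if its neighbourhood is disconnected. Each of the six graphs, for `n ≥ 2`,
has at least `n` special vertices, so a bound for `𝓗`-free graphs forces each of them, for large
`n`, to contain a member of `𝓗`.

Conversely, by Ramsey's theorem many special vertices include a large clique or a large independent
set. For a clique `Q`, the set `Q \ {x}` lies in one component of `N(x)`, and a neighbour `w x` in
another component sees nothing else of `Q`; Ramsey on the `w x` gives `CK_n` or `K*_n`
(`hasUnavoidable_of_clique`). For an independent set, each vertex has two nonadjacent neighbours. If
some vertex sees much of the set, `hasUnavoidable_of_common_neighbor` gives `K_{2,n}`, `K*_n` or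
`K*_{1,n}`. Otherwise the chosen neighbours can be made private, and they give `K*_n`, `K_{2,n}` or
`nP_3` (`hasUnavoidable_of_independent`). The tool for privacy is the digraph lemma
`common_or_independent`. -/

namespace LocalComponent

universe w

/-! ### Ramsey theorems for ordered pairs, symmetric relations and digraphs -/

section Ramsey

/-- The usual induction, splitting on the least element `m`: putting `m` back creates only pairs
with `m` first, so `r` need not be symmetric. -/
theorem ramsey_ordered (k l : ℕ) : ∃ N : ℕ, ∀ (α : Type u) [LinearOrder α] (r : α → α → Prop)
    (s : Finset α), N ≤ s.card →
    (∃ t ⊆ s, t.card = k ∧ ∀ x ∈ t, ∀ y ∈ t, x < y → r x y) ∨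
    (∃ t ⊆ s, t.card = l ∧ ∀ x ∈ t, ∀ y ∈ t, x < y → ¬ r x y) := by
  classical
  induction k generalizing l with
  | zero => exact ⟨0, fun α _ r s _ => Or.inl ⟨∅, by simp, by simp, by simp⟩⟩
  | succ k ihk =>
    induction l with
    | zero => exact ⟨0, fun α _ r s _ => Or.inr ⟨∅, by simp, by simp, by simp⟩⟩
    | succ l ihl =>
      obtain ⟨N₁, h₁⟩ := ihk (l + 1)
      obtain ⟨N₂, h₂⟩ := ihl
      refine ⟨N₁ + N₂ + 1, fun α _ r s hs => ?_⟩
      have hne : s.Nonempty := Finset.card_pos.mp (by omega)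
      set m := s.min' hne with hm
      have hms : m ∈ s := s.min'_mem hne
      have hlt : ∀ x ∈ s.erase m, m < x := fun x hx =>
        lt_of_le_of_ne (s.min'_le x (Finset.mem_of_mem_erase hx)) (Finset.ne_of_mem_erase hx).symm
      have hcard := Finset.card_filter_add_card_filter_not (s := s.erase m) (fun x => r m x)
      rw [Finset.card_erase_of_mem hms] at hcard
      have extend : ∀ (p : α → α → Prop) (t : Finset α), t ⊆ (s.erase m).filter (fun x => p m x) →
          (∀ x ∈ t, ∀ y ∈ t, x < y → p x y) →
          insert m t ⊆ s ∧ (insert m t).card = t.card + 1 ∧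
            ∀ x ∈ insert m t, ∀ y ∈ insert m t, x < y → p x y := by
        intro p t ht hp
        have hmem : ∀ x ∈ t, m < x ∧ x ∈ s ∧ p m x := fun x hx => by
          have := Finset.mem_filter.mp (ht hx)
          exact ⟨hlt x this.1, Finset.mem_of_mem_erase this.1, this.2⟩
        refine ⟨Finset.insert_subset hms fun x hx => (hmem x hx).2.1,
          Finset.card_insert_of_notMem fun h => (hmem m h).1.false, fun x hx y hy hxy => ?_⟩
        rcases Finset.mem_insert.mp hx with rfl | hx
        · rcases Finset.mem_insert.mp hy with rfl | hy
          · exact absurd hxy (lt_irrefl _)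
          · exact (hmem y hy).2.2
        · rcases Finset.mem_insert.mp hy with rfl | hy
          · exact absurd hxy (hmem x hx).1.asymm
          · exact hp x hx y hy hxy
      have hsub : ∀ (p : α → Prop) [DecidablePred p], (s.erase m).filter p ⊆ s := fun p _ =>
        (Finset.filter_subset _ _).trans (Finset.erase_subset _ _)
      by_cases hN : N₁ ≤ ((s.erase m).filter fun x => r m x).card
      · rcases h₁ α r _ hN with ⟨t, ht, hc, hr⟩ | ⟨t, ht, hc, hr⟩
        · obtain ⟨h1, h2, h3⟩ := extend r t ht hr
          exact Or.inl ⟨_, h1, by rw [h2, hc], h3⟩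
        · exact Or.inr ⟨t, ht.trans (hsub _), hc, hr⟩
      · rcases h₂ α r ((s.erase m).filter fun x => ¬ r m x) (by omega) with
          ⟨t, ht, hc, hr⟩ | ⟨t, ht, hc, hr⟩
        · exact Or.inl ⟨t, ht.trans (hsub _), hc, hr⟩
        · obtain ⟨h1, h2, h3⟩ := extend (fun x y => ¬ r x y) t (by convert ht) hr
          exact Or.inr ⟨_, h1, by rw [h2, hc], h3⟩

theorem ramsey_symm (k l : ℕ) : ∃ N : ℕ, ∀ (α : Type u) (r : α → α → Prop), (∀ x y, r x y → r y x) →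
    ∀ s : Finset α, N ≤ s.card →
    (∃ t ⊆ s, t.card = k ∧ ∀ x ∈ t, ∀ y ∈ t, x ≠ y → r x y) ∨
    (∃ t ⊆ s, t.card = l ∧ ∀ x ∈ t, ∀ y ∈ t, x ≠ y → ¬ r x y) := by
  obtain ⟨N, hN⟩ := ramsey_ordered.{u} k l
  refine ⟨N, fun α r hr s hs => ?_⟩
  let _ : LinearOrder α := IsWellOrder.linearOrder WellOrderingRel
  refine (hN α r s hs).imp ?_ ?_
  · rintro ⟨t, ht, hc, h⟩
    exact ⟨t, ht, hc, fun x hx y hy hxy => hxy.lt_or_gt.elim (h x hx y hy)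
      fun hlt => hr _ _ (h y hy x hx hlt)⟩
  · rintro ⟨t, ht, hc, h⟩
    exact ⟨t, ht, hc, fun x hx y hy hxy hxy' => hxy.lt_or_gt.elim (fun hlt => h x hx y hy hlt hxy')
      fun hlt => h y hy x hx hlt (hr _ _ hxy')⟩

/-- A digraph on many vertices has two vertices with many common out-neighbours, or a large
independent set. -/
theorem common_or_independent (n k : ℕ) : ∃ N : ℕ, ∀ (α : Type u) (r : α → α → Prop)
    (s : Finset α), N ≤ s.card →
    (∃ x ∈ s, ∃ x' ∈ s, x ≠ x' ∧ ∃ t ⊆ s, t.card = n ∧ ∀ y ∈ t, r x y ∧ r x' y) ∨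
    (∃ t ⊆ s, t.card = k ∧ ∀ x ∈ t, ∀ y ∈ t, x ≠ y → ¬ r x y) := by
  classical
  -- pairs of sources at one end of a transitively oriented set
  have key : ∀ (α : Type u) (r : α → α → Prop) (f : Fin (n + 2) → α) (x x' : Fin (n + 2)) (s t : Finset α),
      t ⊆ s → (∀ i, f i ∈ t) → f.Injective → x ≠ x' →
      (∀ y, y ≠ x → y ≠ x' → r (f x) (f y) ∧ r (f x') (f y)) →
      ∃ x ∈ s, ∃ x' ∈ s, x ≠ x' ∧ ∃ t ⊆ s, t.card = n ∧ ∀ y ∈ t, r x y ∧ r x' y := by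
    intro α r f x x' s t hts hft hf hx h
    refine ⟨f x, hts (hft x), f x', hts (hft x'), hf.ne hx,
      ((Finset.univ.erase x).erase x').image f, ?_, ?_, ?_⟩
    · intro y hy
      obtain ⟨i, -, rfl⟩ := Finset.mem_image.mp hy
      exact hts (hft i)
    · rw [Finset.card_image_of_injective _ hf, Finset.card_erase_of_mem (by simp [hx.symm]),
        Finset.card_erase_of_mem (by simp)]
      simp
    · intro y hy
      obtain ⟨i, hi, rfl⟩ := Finset.mem_image.mp hy
      simp only [Finset.mem_erase, Finset.mem_univ, and_true] at hi
      exact h i hi.2 hi.1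
  -- Ordered Ramsey is used for upward arcs, then for downward arcs. A set of `n + 2` vertices with
  -- all upward arcs has its two least elements as sources; with all downward arcs, its two
  -- greatest. If both fail, no arcs remain.
  obtain ⟨N₁, h₁⟩ := ramsey_ordered.{u} (n + 2) k
  obtain ⟨N₂, h₂⟩ := ramsey_ordered.{u} (n + 2) N₁
  refine ⟨N₂, fun α r s hs => ?_⟩
  let _ : LinearOrder α := IsWellOrder.linearOrder WellOrderingRel
  rcases h₂ α r s hs with ⟨t, ht, hc, h⟩ | ⟨t, ht, hc, h⟩
  · refine Or.inl (key α r (t.orderEmbOfFin hc) 0 1 s t ht (t.orderEmbOfFin_mem hc)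
      (t.orderEmbOfFin hc).injective (by simp) fun y h0 h1 => ?_)
    have hy : (1 : Fin (n + 2)) < y := by
      rw [Ne, Fin.ext_iff] at h0 h1
      rw [Fin.lt_def]
      simp only [Fin.val_zero, Fin.val_one] at h0 h1 ⊢
      omega
    exact ⟨h _ (t.orderEmbOfFin_mem hc _) _ (t.orderEmbOfFin_mem hc _)
        ((t.orderEmbOfFin hc).strictMono (lt_trans (by simp) hy)),
      h _ (t.orderEmbOfFin_mem hc _) _ (t.orderEmbOfFin_mem hc _)
        ((t.orderEmbOfFin hc).strictMono hy)⟩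
  rcases h₁ α (fun x y => r y x) t hc.ge with ⟨t', ht', hc', h'⟩ | ⟨t', ht', hc', h'⟩
  · have hlt : (⟨n, by omega⟩ : Fin (n + 2)) < ⟨n + 1, by omega⟩ := by simp
    refine Or.inl (key α r (t'.orderEmbOfFin hc') ⟨n, by omega⟩ ⟨n + 1, by omega⟩ s t' (ht'.trans ht)
      (t'.orderEmbOfFin_mem hc') (t'.orderEmbOfFin hc').injective hlt.ne fun y h0 h1 => ?_)
    have hy : y < (⟨n, by omega⟩ : Fin (n + 2)) := by
      have := y.2
      rw [Ne, Fin.ext_iff] at h0 h1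
      rw [Fin.lt_def]
      simp only at h0 h1 ⊢
      omega
    exact ⟨h' _ (t'.orderEmbOfFin_mem hc' _) _ (t'.orderEmbOfFin_mem hc' _)
        ((t'.orderEmbOfFin hc').strictMono hy),
      h' _ (t'.orderEmbOfFin_mem hc' _) _ (t'.orderEmbOfFin_mem hc' _)
        ((t'.orderEmbOfFin hc').strictMono (hy.trans hlt))⟩
  · exact Or.inr ⟨t', ht'.trans ht, hc', fun x hx y hy hxy => hxy.lt_or_gt.elim
      (h x (ht' hx) y (ht' hy)) (h' y hy x hx)⟩

end Ramsey

/-! ### Vertices with disconnected neighbourhood -/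

section LocalStructure

variable (G : FinGraph.{u})

/-- Take `w` in a component of `N(v)` not containing `u`; every common neighbour of `u` and `v` lies
in the component of `u`. -/
theorem exists_separated_neighbor {v u : G.V} (hv : 2 ≤ localComponentNumber G v)
    (hu : G.graph.Adj v u) : ∃ w, G.graph.Adj v w ∧ w ≠ u ∧ ¬ G.graph.Adj u w ∧
      ∀ x, G.graph.Adj v x → G.graph.Adj u x → x ≠ w ∧ ¬ G.graph.Adj x w := by
  have hnt : Nontrivial (G.graph.induce (G.graph.neighborSet v)).ConnectedComponent :=
    Finite.one_lt_card_iff_nontrivial.mp hv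
  obtain ⟨C, hC⟩ := exists_ne
    ((G.graph.induce (G.graph.neighborSet v)).connectedComponentMk ⟨u, hu⟩)
  induction C using SimpleGraph.ConnectedComponent.ind with
  | h w =>
    obtain ⟨w, hw⟩ := w
    have hnr : ¬ (G.graph.induce (G.graph.neighborSet v)).Reachable ⟨u, hu⟩ ⟨w, hw⟩ := fun h =>
      hC (SimpleGraph.ConnectedComponent.sound h.symm)
    have adj : ∀ {x y} (hx : G.graph.Adj v x) (hy : G.graph.Adj v y), G.graph.Adj x y →
        (G.graph.induce (G.graph.neighborSet v)).Reachable ⟨x, hx⟩ ⟨y, hy⟩ :=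
      fun hx hy h => SimpleGraph.Adj.reachable (by simpa using h)
    refine ⟨w, hw, ?_, fun h => hnr (adj hu hw h), fun x hx hux => ⟨?_, fun h =>
      hnr ((adj hu hx hux).trans (adj hx hw h))⟩⟩
    · rintro rfl
      exact hnr (SimpleGraph.Reachable.refl _)
    · rintro rfl
      exact hnr (adj hu hx hux)

theorem exists_neighbor {v : G.V} (hv : 2 ≤ localComponentNumber G v) :
    ∃ u, G.graph.Adj v u := by
  have hnt : Nontrivial (G.graph.induce (G.graph.neighborSet v)).ConnectedComponent :=
    Finite.one_lt_card_iff_nontrivial.mp hv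
  obtain ⟨C, -⟩ := exists_pair_ne (G.graph.induce (G.graph.neighborSet v)).ConnectedComponent
  induction C using SimpleGraph.ConnectedComponent.ind with
  | h w => exact ⟨w.1, w.2⟩

/-- Here `a` is isolated in `N(v)`, so a walk from `a` to `b` has no first edge. -/
theorem two_le_localComponentNumber {v a b : G.V} (ha : G.graph.Adj v a) (hb : G.graph.Adj v b)
    (hab : a ≠ b) (h : ∀ c, G.graph.Adj v c → ¬ G.graph.Adj a c) :
    2 ≤ localComponentNumber G v := by
  refine Finite.one_lt_card_iff_nontrivial.mpr ⟨SimpleGraph.connectedComponentMk _ ⟨a, ha⟩,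
    SimpleGraph.connectedComponentMk _ ⟨b, hb⟩, fun heq => ?_⟩
  obtain ⟨p⟩ := SimpleGraph.ConnectedComponent.exact heq
  cases p with
  | nil => exact hab rfl
  | cons hadj _ => exact h _ (Subtype.prop _) (by simpa using hadj)

end LocalStructure

/-! ### Recognising the unavoidable graphs from indexed vertices -/

section Embeddings

variable {G : FinGraph.{u}} {n : ℕ}

theorem inducedIn_of_map {H : FinGraph.{v}} (f : H.V → G.V) (hf : f.Injective)
    (h : ∀ x y, G.graph.Adj (f x) (f y) ↔ H.graph.Adj x y) : InducedIn H G :=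
  ⟨⟨⟨f, hf⟩, h _ _⟩⟩

theorem InducedIn.trans {H₁ : FinGraph.{u}} {H₂ : FinGraph.{v}} {H₃ : FinGraph.{w}}
    (h : InducedIn H₁ H₂) (h' : InducedIn H₂ H₃) : InducedIn H₁ H₃ :=
  ⟨h'.some.comp h.some⟩

theorem exists_enumeration {α : Type u} {t : Finset α} (h : t.card = n) :
    ∃ f : Fin n → α, f.Injective ∧ ∀ i, f i ∈ t :=
  ⟨fun i => ((t.equivFinOfCardEq h).symm i).1,
    Subtype.val_injective.comp (t.equivFinOfCardEq h).symm.injective, fun _ => Subtype.prop _⟩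

/-- Both the clique and the pendants are given by functions because the special vertices of `t` may
play either role. Distinctness of the images follows from the adjacencies. -/
theorem kStar_inducedIn {t : Finset G.V} (ht : t.card = n) (w q : G.V → G.V)
    (hq : ∀ x ∈ t, ∀ y ∈ t, x ≠ y → G.graph.Adj (q x) (q y))
    (hw : ∀ x ∈ t, ∀ y ∈ t, x ≠ y → ¬ G.graph.Adj (w x) (w y))
    (hqw : ∀ x ∈ t, G.graph.Adj (q x) (w x))
    (hqw' : ∀ x ∈ t, ∀ y ∈ t, x ≠ y → ¬ G.graph.Adj (q x) (w y)) : InducedIn (kStar n) G := by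
  obtain ⟨f, hf, hft⟩ := exists_enumeration ht
  have hff : ∀ {i j}, i ≠ j → f i ≠ f j := hf.ne
  have hne : ∀ i j, q (f i) ≠ w (f j) := fun i j h => by
    by_cases hij : i = j
    · subst hij
      exact (hqw _ (hft i)).ne h
    · exact hw _ (hft j) _ (hft i) (hff (Ne.symm hij)) (h ▸ hqw _ (hft i))
  refine inducedIn_of_map (Sum.elim (fun i => q (f i)) (fun i => w (f i))) ?_ ?_
  · rintro (i | i) (j | j) h
    · by_contra hij
      exact (hq _ (hft i) _ (hft j) (hff fun e => hij (congrArg _ e))).ne h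
    · exact absurd h (hne _ _)
    · exact absurd h.symm (hne _ _)
    · by_contra hij
      refine hqw' _ (hft i) _ (hft j) (hff fun e => hij (congrArg _ e)) ?_
      have h' : w (f i) = w (f j) := h
      exact h' ▸ hqw _ (hft i)
  · rintro (i | i) (j | j) <;> by_cases hij : i = j
    · simp [kStarAdj, hij]
    · simp [kStarAdj, hij, hq _ (hft i) _ (hft j) (hff hij)]
    · simp [kStarAdj, hij, hqw _ (hft j)]
    · simp [kStarAdj, hij, hqw' _ (hft i) _ (hft j) (hff hij)]
    · simp [kStarAdj, hij, (hqw _ (hft j)).symm]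
    · simpa [kStarAdj, hij] using fun h : G.graph.Adj (w (f i)) (q (f j)) =>
        hqw' _ (hft j) _ (hft i) (hff (Ne.symm hij)) h.symm
    · simp [kStarAdj, hij]
    · simp [kStarAdj, hw _ (hft i) _ (hft j) (hff hij)]

theorem cliquePair_inducedIn {t : Finset G.V} (ht : t.card = n) (w : G.V → G.V)
    (hq : ∀ x ∈ t, ∀ y ∈ t, x ≠ y → G.graph.Adj x y)
    (hw : ∀ x ∈ t, ∀ y ∈ t, x ≠ y → G.graph.Adj (w x) (w y))
    (hqw : ∀ x ∈ t, G.graph.Adj x (w x))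
    (hqw' : ∀ x ∈ t, ∀ y ∈ t, x ≠ y → x ≠ w y ∧ ¬ G.graph.Adj x (w y)) :
    InducedIn (cliquePair n) G := by
  obtain ⟨f, hf, hft⟩ := exists_enumeration ht
  have hff : ∀ {i j}, i ≠ j → f i ≠ f j := hf.ne
  have hne : ∀ i j, f i ≠ w (f j) := fun i j h => by
    by_cases hij : i = j
    · subst hij
      exact (hqw _ (hft i)).ne h
    · exact (hqw' _ (hft i) _ (hft j) (hff hij)).1 h
  refine inducedIn_of_map (Sum.elim f (fun i => w (f i))) ?_ ?_
  · rintro (i | i) (j | j) h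
    · exact congrArg _ (hf h)
    · exact absurd h (hne _ _)
    · exact absurd h.symm (hne _ _)
    · by_contra hij
      exact (hw _ (hft i) _ (hft j) (hff fun e => hij (congrArg _ e))).ne h
  · rintro (i | i) (j | j) <;> by_cases hij : i = j
    · simp [cliquePairAdj, hij]
    · simp [cliquePairAdj, hij, hq _ (hft i) _ (hft j) (hff hij)]
    · simp [cliquePairAdj, hij, hqw _ (hft j)]
    · simp [cliquePairAdj, hij, (hqw' _ (hft i) _ (hft j) (hff hij)).2]
    · simp [cliquePairAdj, hij, (hqw _ (hft j)).symm]
    · simpa [cliquePairAdj, hij] using fun h : G.graph.Adj (w (f i)) (f j) =>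
        (hqw' _ (hft j) _ (hft i) (hff (Ne.symm hij))).2 h.symm
    · simp [cliquePairAdj, hij]
    · simp [cliquePairAdj, hij, hw _ (hft i) _ (hft j) (hff hij)]

theorem completeBipartite_inducedIn {t : Finset G.V} (ht : t.card = n) (b : G.V → G.V) {p q : G.V}
    (hpq : p ≠ q) (hpq' : ¬ G.graph.Adj p q)
    (hb : ∀ x ∈ t, ∀ y ∈ t, x ≠ y → b x ≠ b y ∧ ¬ G.graph.Adj (b x) (b y))
    (h : ∀ x ∈ t, G.graph.Adj p (b x) ∧ G.graph.Adj q (b x)) :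
    InducedIn (completeBipartite 2 n) G := by
  obtain ⟨f, hf, hft⟩ := exists_enumeration ht
  have hff : ∀ {i j}, i ≠ j → f i ≠ f j := hf.ne
  have hadj : ∀ i j, G.graph.Adj (![p, q] i) (b (f j)) := by
    intro i j
    fin_cases i
    · exact (h _ (hft j)).1
    · exact (h _ (hft j)).2
  refine inducedIn_of_map (Sum.elim ![p, q] (fun i => b (f i))) ?_ ?_
  · rintro (i | i) (j | j) h
    · fin_cases i <;> fin_cases j <;> simp_all [eq_comm]
    · exact absurd h (hadj _ _).ne
    · exact absurd h.symm (hadj _ _).ne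
    · by_contra hij
      exact (hb _ (hft i) _ (hft j) (hff fun e => hij (congrArg _ e))).1 h
  · rintro (i | i) (j | j)
    · fin_cases i <;> fin_cases j <;> simp [hpq', G.graph.adj_comm q p]
    · simpa using hadj i j
    · simpa using (hadj j i).symm
    · by_cases hij : i = j
      · simp [hij]
      · simpa using (hb _ (hft i) _ (hft j) (hff hij)).2

theorem starStar_inducedIn {t : Finset G.V} (ht : t.card = n) (a : G.V) (b : G.V → G.V)
    (ha : ∀ x ∈ t, G.graph.Adj a x) (hab : ∀ x ∈ t, b x ≠ a ∧ ¬ G.graph.Adj a (b x))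
    (hb : ∀ x ∈ t, G.graph.Adj x (b x))
    (htt : ∀ x ∈ t, ∀ y ∈ t, ¬ G.graph.Adj x y)
    (hbb : ∀ x ∈ t, ∀ y ∈ t, ¬ G.graph.Adj (b x) (b y))
    (hbt : ∀ x ∈ t, ∀ y ∈ t, x ≠ y → ¬ G.graph.Adj (b x) y) :
    InducedIn (starStar n) G := by
  obtain ⟨f, hf, hft⟩ := exists_enumeration ht
  have hff : ∀ {i j}, i ≠ j → f i ≠ f j := hf.ne
  have hne : ∀ i j, f i ≠ b (f j) := fun i j h =>
    htt _ (hft j) _ (hft i) (h ▸ hb _ (hft j))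
  refine inducedIn_of_map (Sum.elim (fun _ => a) (Sum.elim f (fun i => b (f i)))) ?_ ?_
  · rintro (i | i | i) (j | j | j) h
    · rfl
    · exact absurd h (ha _ (hft j)).ne
    · exact absurd h.symm (hab _ (hft j)).1
    · exact absurd h.symm (ha _ (hft i)).ne
    · exact congrArg _ (congrArg _ (hf h))
    · exact absurd h (hne _ _)
    · exact absurd h (hab _ (hft i)).1
    · exact absurd h.symm (hne _ _)
    · by_contra hij
      refine hbt _ (hft i) _ (hft j) (hff fun e => hij (by rw [e])) ?_
      have h' : b (f i) = b (f j) := h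
      exact h' ▸ (hb _ (hft j)).symm
  · rintro (i | i | i) (j | j | j)
    · simp [starStarAdj]
    · simpa [starStarAdj] using ha _ (hft j)
    · simpa [starStarAdj] using (hab _ (hft j)).2
    · simpa [starStarAdj] using (ha _ (hft i)).symm
    · simpa [starStarAdj] using htt _ (hft i) _ (hft j)
    · by_cases hij : i = j
      · simpa [starStarAdj, hij] using hb _ (hft j)
      · simpa [starStarAdj, hij] using fun h => hbt _ (hft j) _ (hft i) (hff (Ne.symm hij)) h.symm
    · simpa [starStarAdj] using fun h => (hab _ (hft i)).2 h.symm
    · by_cases hij : i = j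
      · simpa [starStarAdj, hij] using (hb _ (hft j)).symm
      · simpa [starStarAdj, hij] using hbt _ (hft i) _ (hft j) (hff hij)
    · simpa [starStarAdj] using hbb _ (hft i) _ (hft j)

theorem copies_path_inducedIn {t : Finset G.V} (ht : t.card = n) (a b : G.V → G.V)
    (ha : ∀ x ∈ t, G.graph.Adj x (a x)) (hb : ∀ x ∈ t, G.graph.Adj x (b x))
    (hab : ∀ x ∈ t, a x ≠ b x)
    (htt : ∀ x ∈ t, ∀ y ∈ t, ¬ G.graph.Adj x y)
    (haa : ∀ x ∈ t, ∀ y ∈ t, ¬ G.graph.Adj (a x) (a y))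
    (hbb : ∀ x ∈ t, ∀ y ∈ t, ¬ G.graph.Adj (b x) (b y))
    (hab' : ∀ x ∈ t, ∀ y ∈ t, ¬ G.graph.Adj (a x) (b y))
    (hat : ∀ x ∈ t, ∀ y ∈ t, x ≠ y → ¬ G.graph.Adj (a x) y)
    (hbt : ∀ x ∈ t, ∀ y ∈ t, x ≠ y → ¬ G.graph.Adj (b x) y) :
    InducedIn (copies n (path 3)) G := by
  obtain ⟨f, hf, hft⟩ := exists_enumeration ht
  have hff : ∀ {i j}, i ≠ j → f i ≠ f j := hf.ne
  have hfa : ∀ i j, f i ≠ a (f j) := fun i j h => htt _ (hft j) _ (hft i) (h ▸ ha _ (hft j))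
  have hfb : ∀ i j, f i ≠ b (f j) := fun i j h => htt _ (hft j) _ (hft i) (h ▸ hb _ (hft j))
  have hab'' : ∀ i j, a (f i) ≠ b (f j) := fun i j h => by
    by_cases hij : i = j
    · exact hab _ (hft j) (hij ▸ h)
    · exact hbt _ (hft j) _ (hft i) (hff (Ne.symm hij)) (h ▸ (ha _ (hft i)).symm)
  have hai : ∀ i j, a (f i) = a (f j) → i = j := fun i j h => by
    by_contra hij
    exact hat _ (hft i) _ (hft j) (hff hij) (h ▸ (ha _ (hft j)).symm)
  have hbi : ∀ i j, b (f i) = b (f j) → i = j := fun i j h => by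
    by_contra hij
    exact hbt _ (hft i) _ (hft j) (hff hij) (h ▸ (hb _ (hft j)).symm)
  have haf : ∀ i j, G.graph.Adj (a (f i)) (f j) ↔ i = j := fun i j =>
    ⟨fun h => by_contra fun hij => hat _ (hft i) _ (hft j) (hff hij) h,
      fun h => h ▸ (ha _ (hft i)).symm⟩
  have hbf : ∀ i j, G.graph.Adj (b (f i)) (f j) ↔ i = j := fun i j =>
    ⟨fun h => by_contra fun hij => hbt _ (hft i) _ (hft j) (hff hij) h,
      fun h => h ▸ (hb _ (hft i)).symm⟩
  refine inducedIn_of_map (fun x => ![a (f x.1), f x.1, b (f x.1)] x.2) ?_ ?_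
  · rintro ⟨i, k⟩ ⟨j, l⟩ h
    fin_cases k <;> fin_cases l
    · exact congrArg (·, _) (hai _ _ h)
    · exact absurd h.symm (hfa _ _)
    · exact absurd h (hab'' _ _)
    · exact absurd h (hfa _ _)
    · exact congrArg (·, _) (hf h)
    · exact absurd h (hfb _ _)
    · exact absurd h.symm (hab'' _ _)
    · exact absurd h.symm (hfb _ _)
    · exact congrArg (·, _) (hbi _ _ h)
  · rintro ⟨i, k⟩ ⟨j, l⟩
    fin_cases k <;> fin_cases l
    · simpa [SimpleGraph.pathGraph_adj] using haa _ (hft i) _ (hft j)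
    · simpa [SimpleGraph.pathGraph_adj] using haf i j
    · simpa [SimpleGraph.pathGraph_adj] using hab' _ (hft i) _ (hft j)
    · simpa [SimpleGraph.pathGraph_adj, eq_comm] using (G.graph.adj_comm _ _).trans (haf j i)
    · simpa [SimpleGraph.pathGraph_adj] using htt _ (hft i) _ (hft j)
    · simpa [SimpleGraph.pathGraph_adj, eq_comm] using (G.graph.adj_comm _ _).trans (hbf j i)
    · simpa [SimpleGraph.pathGraph_adj] using fun h => hab' _ (hft j) _ (hft i) h.symm
    · simpa [SimpleGraph.pathGraph_adj] using hbf i j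
    · simpa [SimpleGraph.pathGraph_adj] using hbb _ (hft i) _ (hft j)

end Embeddings

/-! ### Many special vertices force an unavoidable graph -/

section Unavoidable

/-- `G` contains one of the unavoidable graphs of order parameter `n`; `T_n` is not listed
because it contains `K_{2,n}`. -/
def HasUnavoidable (n : ℕ) (G : FinGraph.{u}) : Prop :=
  InducedIn (kStar n) G ∨ InducedIn (copies n (path 3)) G ∨ InducedIn (starStar n) G ∨
    InducedIn (completeBipartite 2 n) G ∨ InducedIn (cliquePair n) G

theorem not_adj_of_ne (G : FinGraph.{u}) {t : Finset G.V} {f : G.V → G.V}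
    (h : ∀ x ∈ t, ∀ y ∈ t, x ≠ y → ¬ G.graph.Adj (f x) (f y)) :
    ∀ x ∈ t, ∀ y ∈ t, ¬ G.graph.Adj (f x) (f y) := fun x hx y hy hxy =>
  h x hx y hy (by rintro rfl; exact G.graph.irrefl hxy) hxy

theorem hasUnavoidable_of_clique (n : ℕ) : ∃ N : ℕ, ∀ (G : FinGraph.{u}) (Q : Finset G.V), N ≤ Q.card →
    (∀ x ∈ Q, 2 ≤ localComponentNumber G x) →
    (∀ x ∈ Q, ∀ y ∈ Q, x ≠ y → G.graph.Adj x y) → HasUnavoidable n G := by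
  obtain ⟨N, hN⟩ := ramsey_symm.{u} n n
  refine ⟨N + 2, fun G Q hQ hc hadj => ?_⟩
  have hw : ∀ x, ∃ w, x ∈ Q → G.graph.Adj x w ∧
      ∀ y ∈ Q, y ≠ x → y ≠ w ∧ ¬ G.graph.Adj y w := by
    intro x
    by_cases hx : x ∈ Q
    -- Any other `u ∈ Q` will do: the rest of `Q` is adjacent to `u`, so separating `w` from `u`
    -- separates it from all of `Q \ {x}`.
    · obtain ⟨u, hu, hux⟩ := Finset.exists_mem_ne (s := Q) (by omega) x
      obtain ⟨w, hw, hwu, huw, h⟩ :=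
        exists_separated_neighbor G (hc x hx) (hadj x hx u hu hux.symm)
      refine ⟨w, fun _ => ⟨hw, fun y hy hyx => ?_⟩⟩
      by_cases hyu : y = u
      · subst hyu
        exact ⟨hwu.symm, huw⟩
      · exact h y (hadj x hx y hy hyx.symm) (hadj u hu y hy (Ne.symm hyu))
    · exact ⟨x, fun h => absurd h hx⟩
  choose w hw using hw
  rcases hN _ (fun x y => G.graph.Adj (w x) (w y)) (fun _ _ h => h.symm) Q (by omega) with
    ⟨t, ht, hct, h⟩ | ⟨t, ht, hct, h⟩
  · exact Or.inr <| Or.inr <| Or.inr <| Or.inr <| cliquePair_inducedIn hct w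
      (fun x hx y hy => hadj x (ht hx) y (ht hy)) h (fun x hx => (hw x (ht hx)).1)
      (fun x hx y hy hxy => (hw y (ht hy)).2 x (ht hx) hxy)
  · exact Or.inl <| kStar_inducedIn hct w id
      (fun x hx y hy => hadj x (ht hx) y (ht hy)) h (fun x hx => (hw x (ht hx)).1)
      (fun x hx y hy hxy => ((hw y (ht hy)).2 x (ht hx) hxy).2)

/-- Each `x ∈ I` has a neighbour `b x` not adjacent to `a`. If one `b x` sees `n` vertices of `I`,
these form `K_{2,n}` with `a` and `b x`. Otherwise the `b x` may be taken private to `x`: a clique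
among them gives `K*_n` with `I` as pendants, an independent set gives `K*_{1,n}` with centre `a`.
-/
theorem hasUnavoidable_of_common_neighbor (n : ℕ) : ∃ N : ℕ, ∀ (G : FinGraph.{u}) (a : G.V)
    (I : Finset G.V), N ≤ I.card → (∀ x ∈ I, 2 ≤ localComponentNumber G x) →
    (∀ x ∈ I, G.graph.Adj a x) → (∀ x ∈ I, ∀ y ∈ I, ¬ G.graph.Adj x y) → HasUnavoidable n G := by
  obtain ⟨N₁, h₁⟩ := ramsey_symm.{u} n n
  obtain ⟨N₂, h₂⟩ := common_or_independent.{u} n N₁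
  refine ⟨N₂, fun G a I hI hc ha hind => ?_⟩
  have hb : ∀ x, ∃ b, x ∈ I → G.graph.Adj x b ∧ b ≠ a ∧ ¬ G.graph.Adj a b := by
    intro x
    by_cases hx : x ∈ I
    · obtain ⟨w, hw, hwa, haw, -⟩ := exists_separated_neighbor G (hc x hx) (ha x hx).symm
      exact ⟨w, fun _ => ⟨hw, hwa, haw⟩⟩
    · exact ⟨x, fun h => absurd h hx⟩
  choose b hb using hb
  rcases h₂ _ (fun x y => G.graph.Adj (b x) y) I hI with
    ⟨x, hx, _, -, -, t, ht, hct, h⟩ | ⟨t, ht, hct, h⟩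
  · exact Or.inr <| Or.inr <| Or.inr <| Or.inl <| completeBipartite_inducedIn hct id
      (hb x hx).2.1.symm (hb x hx).2.2
      (fun x hx y hy hxy => ⟨hxy, hind x (ht hx) y (ht hy)⟩)
      (fun y hy => ⟨ha y (ht hy), (h y hy).1⟩)
  rcases h₁ _ (fun x y => G.graph.Adj (b x) (b y)) (fun _ _ h => h.symm) t hct.ge with
    ⟨t', ht', hct', h'⟩ | ⟨t', ht', hct', h'⟩
  · exact Or.inl <| kStar_inducedIn hct' id b h'
      (fun x hx y hy _ => hind x (ht (ht' hx)) y (ht (ht' hy)))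
      (fun x hx => (hb x (ht (ht' hx))).1.symm)
      (fun x hx y hy => h x (ht' hx) y (ht' hy))
  · exact Or.inr <| Or.inr <| Or.inl <| starStar_inducedIn hct' a b
      (fun x hx => ha x (ht (ht' hx))) (fun x hx => (hb x (ht (ht' hx))).2)
      (fun x hx => (hb x (ht (ht' hx))).1)
      (fun x hx y hy => hind x (ht (ht' hx)) y (ht (ht' hy)))
      (not_adj_of_ne G h') (fun x hx y hy => h x (ht' hx) y (ht' hy))

theorem hasUnavoidable_of_independent (n : ℕ) : ∃ N : ℕ, ∀ (G : FinGraph.{u}) (I : Finset G.V),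
    N ≤ I.card → (∀ x ∈ I, 2 ≤ localComponentNumber G x) →
    (∀ x ∈ I, ∀ y ∈ I, ¬ G.graph.Adj x y) → HasUnavoidable n G := by
  -- The thresholds are spent from `N₅` down to `N₁`: making the `a x` private, then the `b x`
  -- private, then the `a x` independent, then the `b x` independent, and finally removing edges
  -- between `a x` and `b y`.
  obtain ⟨M, hM⟩ := hasUnavoidable_of_common_neighbor.{u} n
  obtain ⟨N₁, h₁⟩ := common_or_independent.{u} n n
  obtain ⟨N₂, h₂⟩ := ramsey_symm.{u} n N₁
  obtain ⟨N₃, h₃⟩ := ramsey_symm.{u} n N₂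
  obtain ⟨N₄, h₄⟩ := common_or_independent.{u} M N₃
  obtain ⟨N₅, h₅⟩ := common_or_independent.{u} M N₄
  refine ⟨N₅, fun G I hI hc hind => ?_⟩
  have hab : ∀ x, ∃ a b, x ∈ I → G.graph.Adj x a ∧ G.graph.Adj x b ∧ a ≠ b ∧
      ¬ G.graph.Adj a b := by
    intro x
    by_cases hx : x ∈ I
    · obtain ⟨u, hu⟩ := exists_neighbor G (hc x hx)
      obtain ⟨w, hw, hwu, huw, -⟩ := exists_separated_neighbor G (hc x hx) hu
      exact ⟨u, w, fun _ => ⟨hu, hw, hwu.symm, huw⟩⟩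
    · exact ⟨x, x, fun h => absurd h hx⟩
  choose a b hab using hab
  have common : ∀ c : G.V, ∀ t ⊆ I, t.card = M → (∀ y ∈ t, G.graph.Adj c y) →
      HasUnavoidable n G := fun c t ht hct h =>
    hM G c t hct.ge (fun x hx => hc x (ht hx)) h (fun x hx y hy => hind x (ht hx) y (ht hy))
  rcases h₅ _ (fun x y => G.graph.Adj (a x) y) I hI with
    ⟨x, -, _, -, -, t, ht, hct, h⟩ | ⟨t₁, ht₁, hct₁, hat⟩
  · exact common (a x) t ht hct fun y hy => (h y hy).1
  rcases h₄ _ (fun x y => G.graph.Adj (b x) y) t₁ hct₁.ge with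
    ⟨x, -, _, -, -, t, ht, hct, h⟩ | ⟨t₂, ht₂, hct₂, hbt⟩
  · exact common (b x) t (ht.trans ht₁) hct fun y hy => (h y hy).1
  rcases h₃ _ (fun x y => G.graph.Adj (a x) (a y)) (fun _ _ h => h.symm) t₂ hct₂.ge with
    ⟨t, ht, hct, h⟩ | ⟨t₃, ht₃, hct₃, haa⟩
  · have hs := ht.trans ht₂
    exact Or.inl <| kStar_inducedIn hct id a h
      (fun x hx y hy _ => hind x (ht₁ (hs hx)) y (ht₁ (hs hy)))
      (fun x hx => (hab x (ht₁ (hs hx))).1.symm) (fun x hx y hy => hat x (hs hx) y (hs hy))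
  rcases h₂ _ (fun x y => G.graph.Adj (b x) (b y)) (fun _ _ h => h.symm) t₃ hct₃.ge with
    ⟨t, ht, hct, h⟩ | ⟨t₄, ht₄, hct₄, hbb⟩
  · have hs := ht.trans ht₃
    exact Or.inl <| kStar_inducedIn hct id b h
      (fun x hx y hy _ => hind x (ht₁ (ht₂ (hs hx))) y (ht₁ (ht₂ (hs hy))))
      (fun x hx => (hab x (ht₁ (ht₂ (hs hx)))).2.1.symm)
      (fun x hx y hy => hbt x (hs hx) y (hs hy))
  have hs₂ := ht₄.trans ht₃
  have hs₁ := hs₂.trans ht₂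
  have hsI := hs₁.trans ht₁
  have inj : ∀ f : G.V → G.V, (∀ x ∈ t₄, G.graph.Adj x (f x)) →
      (∀ x ∈ t₄, ∀ y ∈ t₄, x ≠ y → ¬ G.graph.Adj (f x) y) →
      ∀ x ∈ t₄, ∀ y ∈ t₄, x ≠ y → f x ≠ f y := fun f hf hft x hx y hy hxy h =>
    hft x hx y hy hxy (h ▸ (hf y hy).symm)
  have hat' : ∀ x ∈ t₄, ∀ y ∈ t₄, x ≠ y → ¬ G.graph.Adj (a x) y :=
    fun x hx y hy => hat x (hs₁ hx) y (hs₁ hy)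
  have hbt' : ∀ x ∈ t₄, ∀ y ∈ t₄, x ≠ y → ¬ G.graph.Adj (b x) y :=
    fun x hx y hy => hbt x (hs₂ hx) y (hs₂ hy)
  have haa' : ∀ x ∈ t₄, ∀ y ∈ t₄, ¬ G.graph.Adj (a x) (a y) :=
    fun x hx y hy => not_adj_of_ne G haa x (ht₄ hx) y (ht₄ hy)
  -- Here both sources matter: `a x` and `a x'` form the side of order two in `K_{2,n}`, and are
  -- distinct by privacy. Without cross edges the paths `a x, x, b x` form `nP_3`.
  rcases h₁ _ (fun x y => G.graph.Adj (a x) (b y)) t₄ hct₄.ge with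
    ⟨x, hx, x', hx', hxx', t, ht, hct, h⟩ | ⟨t, ht, hct, h⟩
  · exact Or.inr <| Or.inr <| Or.inr <| Or.inl <| completeBipartite_inducedIn hct b
      (inj a (fun x hx => (hab x (hsI hx)).1) hat' x hx x' hx' hxx') (haa' x hx x' hx')
      (fun x hx y hy hxy => ⟨inj b (fun x hx => (hab x (hsI hx)).2.1) hbt' x (ht hx) y (ht hy) hxy,
        hbb x (ht hx) y (ht hy) hxy⟩) h
  · refine Or.inr <| Or.inl <| copies_path_inducedIn hct a b
      (fun x hx => (hab x (hsI (ht hx))).1) (fun x hx => (hab x (hsI (ht hx))).2.1)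
      (fun x hx => (hab x (hsI (ht hx))).2.2.1)
      (fun x hx y hy => hind x (hsI (ht hx)) y (hsI (ht hy)))
      (fun x hx y hy => haa' x (ht hx) y (ht hy))
      (fun x hx y hy => not_adj_of_ne G hbb x (ht hx) y (ht hy)) ?_
      (fun x hx y hy => hat' x (ht hx) y (ht hy)) (fun x hx y hy => hbt' x (ht hx) y (ht hy))
    intro x hx y hy
    by_cases hxy : x = y
    · subst hxy
      exact (hab x (hsI (ht hx))).2.2.2
    · exact h x hx y hy hxy

theorem hasUnavoidable_of_many (n : ℕ) : ∃ N : ℕ, ∀ G : FinGraph.{u},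
    N ≤ countGE localComponentNumber 2 G → HasUnavoidable n G := by
  classical
  obtain ⟨N₁, h₁⟩ := hasUnavoidable_of_clique.{u} n
  obtain ⟨N₂, h₂⟩ := hasUnavoidable_of_independent.{u} n
  obtain ⟨N, hN⟩ := ramsey_symm.{u} N₁ N₂
  refine ⟨N, fun G hG => ?_⟩
  have hfin : {v : G.V | 2 ≤ localComponentNumber G v}.Finite := Set.toFinite _
  rcases hN G.V G.graph.Adj (fun _ _ h => h.symm) hfin.toFinset
    (by rwa [← Set.ncard_eq_toFinset_card]) with ⟨t, ht, hc, h⟩ | ⟨t, ht, hc, h⟩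
  · exact h₁ G t hc.ge (fun x hx => by simpa using ht hx) h
  · exact h₂ G t hc.ge (fun x hx => by simpa using ht hx) (not_adj_of_ne G (f := id) h)

end Unavoidable

/-! ### The six graphs have many special vertices -/

section Necessity

/-- A copy of a graph in a larger universe. -/
def lift (G : FinGraph.{0}) : FinGraph.{u} where
  V := ULift.{u} G.V
  graph := G.graph.comap ULift.down

theorem lift_inducedIn (G : FinGraph.{0}) : InducedIn (lift.{u} G) G :=
  inducedIn_of_map ULift.down ULift.down_injective fun _ _ => Iff.rfl

/-- In all six graphs the special vertices can be certified by a vertex `a` isolated in the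
neighbourhood and any second neighbour `b`. The lift is needed because `B₂` only bounds graphs in
the universe of `𝓗`. -/
theorem le_countGE_lift {G : FinGraph.{0}} {n : ℕ} (f : Fin n → G.V) (hf : f.Injective)
    (h : ∀ i, ∃ a b, G.graph.Adj (f i) a ∧ G.graph.Adj (f i) b ∧ a ≠ b ∧
      ∀ c, G.graph.Adj (f i) c → ¬ G.graph.Adj a c) :
    n ≤ countGE localComponentNumber 2 (lift.{u} G) := by
  have hg : (fun i => ULift.up.{u} (f i)).Injective := ULift.up_injective.comp hf
  calc n = (Set.range fun i => ULift.up.{u} (f i)).ncard := by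
        rw [← Set.image_univ, Set.ncard_image_of_injective _ hg, Set.ncard_univ, Nat.card_fin]
    _ ≤ _ := by
        refine Set.ncard_le_ncard ?_ (Set.toFinite {v : (lift.{u} G).V | 2 ≤ _})
        rintro _ ⟨i, rfl⟩
        obtain ⟨a, b, ha, hb, hab, hc⟩ := h i
        exact two_le_localComponentNumber (lift G) (a := ULift.up a) (b := ULift.up b) ha hb
          (ULift.up_injective.ne hab) fun c hvc => hc c.down hvc

variable (n : ℕ)

theorem le_countGE_kStar (hn : 2 ≤ n) :
    n ≤ countGE localComponentNumber 2 (lift.{u} (kStar n)) := by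
  have : Nontrivial (Fin n) := Fin.nontrivial_iff_two_le.mpr hn
  refine le_countGE_lift .inl Sum.inl_injective fun i => ?_
  obtain ⟨j, hj⟩ := exists_ne i
  refine ⟨.inr i, .inl j, by simp [kStarAdj], by simpa [kStarAdj] using hj.symm, by simp, ?_⟩
  rintro (c | c) <;> simp [kStarAdj]

theorem le_countGE_copies :
    n ≤ countGE localComponentNumber 2 (lift.{u} (copies n (path 3))) := by
  refine le_countGE_lift (fun i => (i, 1)) (fun i j h => congrArg Prod.fst h) fun i => ?_
  refine ⟨(i, 0), (i, 2), by simp [SimpleGraph.pathGraph_adj], by simp [SimpleGraph.pathGraph_adj],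
    by simp, ?_⟩
  rintro ⟨c, k⟩
  fin_cases k <;> simp [SimpleGraph.pathGraph_adj]

theorem le_countGE_starStar :
    n ≤ countGE localComponentNumber 2 (lift.{u} (starStar n)) := by
  refine le_countGE_lift (fun i => .inr (.inl i))
    (Sum.inr_injective.comp Sum.inl_injective) fun i => ?_
  refine ⟨.inr (.inr i), .inl (), by simp [starStarAdj], by simp [starStarAdj], by simp, ?_⟩
  rintro (c | c | c) <;> simp [starStarAdj]

theorem le_countGE_completeBipartite :
    n ≤ countGE localComponentNumber 2 (lift.{u} (completeBipartite 2 n)) := by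
  refine le_countGE_lift .inr Sum.inr_injective fun i => ?_
  refine ⟨.inl 0, .inl 1, by simp, by simp, by simp, ?_⟩
  rintro (c | c) <;> simp

theorem le_countGE_cliquePair (hn : 2 ≤ n) :
    n ≤ countGE localComponentNumber 2 (lift.{u} (cliquePair n)) := by
  have : Nontrivial (Fin n) := Fin.nontrivial_iff_two_le.mpr hn
  refine le_countGE_lift .inl Sum.inl_injective fun i => ?_
  obtain ⟨j, hj⟩ := exists_ne i
  refine ⟨.inr i, .inl j, by simp [cliquePairAdj], by simpa [cliquePairAdj] using hj.symm,
    by simp, ?_⟩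
  rintro (c | c) <;> simp [cliquePairAdj]

theorem le_countGE_tGraph (hn : 1 ≤ n) :
    n ≤ countGE localComponentNumber 2 (lift.{u} (tGraph n)) := by
  refine le_countGE_lift (fun i => .inr (.inl i))
    (Sum.inr_injective.comp Sum.inl_injective) fun i => ?_
  refine ⟨.inr (.inr ()), .inl ⟨0, hn⟩, by simp [tAdj], by simp [tAdj], by simp, ?_⟩
  rintro (c | c | c) <;> simp [tAdj]

end Necessity

end LocalComponent

/-! ### The equivalence -/

theorem mainTheorem10 (𝓗 : Set LocalComponent.FinGraph.{u}) :
    𝓗 ∈ LocalComponent.B₂ LocalComponent.localComponentNumber ↔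
      ∃ n : ℕ, 1 ≤ n ∧
        LocalComponent.FamilyLE 𝓗
          {LocalComponent.kStar n,
            LocalComponent.copies n (LocalComponent.path 3),
            LocalComponent.starStar n,
            LocalComponent.completeBipartite 2 n,
            LocalComponent.cliquePair n,
            LocalComponent.tGraph n} := by
  open LocalComponent in
  constructor
  · rintro ⟨c, hc⟩
    have key : ∀ G : FinGraph.{0}, c + 2 ≤ countGE localComponentNumber 2 (lift.{u} G) →
        ∃ H ∈ 𝓗, InducedIn H G := by
      intro G hG
      by_contra hfree
      have := hc (lift G) fun ⟨H, hH, hHG⟩ => hfree ⟨H, hH, hHG.trans (lift_inducedIn G)⟩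
      omega
    -- The value `c + 2` passes the bound `c` and is at least 2, as needed for a second neighbour in
    -- `K*_n` and `CK_n`.
    refine ⟨c + 2, by omega, ?_⟩
    rintro G (rfl | rfl | rfl | rfl | rfl | rfl)
    · exact key _ (le_countGE_kStar _ (by omega))
    · exact key _ (le_countGE_copies _)
    · exact key _ (le_countGE_starStar _)
    · exact key _ (le_countGE_completeBipartite _)
    · exact key _ (le_countGE_cliquePair _ (by omega))
    · exact key _ (le_countGE_tGraph _ (by omega))
  · rintro ⟨n, -, hle⟩
    obtain ⟨N, hN⟩ := hasUnavoidable_of_many.{u} n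
    refine ⟨N, fun G hfree => not_le.mp fun hG => hfree ?_⟩
    have key : ∀ K : FinGraph.{0}, InducedIn K G → (∃ H ∈ 𝓗, InducedIn H K) →
        ∃ H ∈ 𝓗, InducedIn H G := fun K hK ⟨H, hH, hHK⟩ => ⟨H, hH, hHK.trans hK⟩
    -- Five cases suffice: `T_n` contains `K_{2,n}`, formed by `E_n`, the new vertex and one vertex
    -- of `K_n`.
    rcases hN G hG with h | h | h | h | h <;> exact key _ h (hle _ (by simp))
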